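/- Let $n\ge 1$ and let $G\subset\mathbb R^n$ be a convex body, i.e. a compact convex set with non-empty interior. Let $\mathcal K(G)$ be the set of all non-empty compact convex subsets of $G$, and let $d_{\mathcal H}$ be the Hausdorff distance (for the Euclidean norm). For $K,L\in\mathcal K(G)$ put $$d_G(K,L)=\sum_{j=1}^{n}\bigl(2\,\mathrm{MV}_j(G,K\,\widetilde\cup\,L)-\mathrm{MV}_j(G,K)-\mathrm{MV}_j(G,L)\bigr),$$ where $K\,\widetilde\cup\,L$ is the closed convex hull of $K\cup L$, and $\mathrm{MV}_j(G,K)=\mathrm{MV}(G,\dots,G,K,\dots,K)$ is the mixed volume with $n-j$ entries $G$ and $j$ entries $K$, normalized so that $\mathrm{MV}(K,\dots,K)=\mathrm{Vol}(K)$; explicitly, $\mathrm{MV}(K_1,\dots,K_n)=\frac1{n!}\sum_{S\subseteq\{1,\dots,n\}}(-1)^{n-|S|}\,\mathrm{Vol}\bigl(\sum_{i\in S}K_i\bigr)$. Then: 1. For every real $\beta>1$ there is no $C>0$ such that $d_G(K,L)\le C\,d_{\mathcal H}(K,L)^{\beta}$ for all $K,L\in\mathcal K(G)$. 2. For every real $p<\frac{n+1}{2}$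 there is no $C>0$ such that $C\,d_{\mathcal H}(K,L)^{p}\le d_G(K,L)$ for all $K,L\in\mathcal K(G)$ with $K\ne L$. 3. If $G$ is a convex polytope (the convex hull of finitely many points), then for every real $p<n$ there is no $C>0$ such that $C\,d_{\mathcal H}(K,L)^{p}\le d_G(K,L)$ for all $K,L\in\mathcal K(G)$ with $K\ne L$. -/

import Mathlib

open MeasureTheory
open scoped Pointwise

/-- The mixed volume `MV(K₁, …, Kₙ)` of `n` sets in `ℝⁿ`, by the polarization formula
`MV(K₁, …, Kₙ) = (1 / n!) ∑_{S ⊆ {1, …, n}} (-1) ^ (n - |S|) Vol(∑_{i ∈ S} Kᵢ)`. -/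
noncomputable def mixedVolume {n : ℕ} (K : Fin n → Set (EuclideanSpace ℝ (Fin n))) : ℝ :=
  ((n.factorial : ℝ))⁻¹ *
    ∑ S : Finset (Fin n), (-1 : ℝ) ^ (n - S.card) * (volume (∑ i ∈ S, K i)).toReal

/-- `M` is a mixed volume function: a nonnegative symmetric function of `n` nonempty compact convex
sets in `ℝⁿ` with
`Vol(t₁ K₁ + ⋯ + tₙ Kₙ) = ∑_{i₁, …, iₙ} t_{i₁} ⋯ t_{iₙ} M(K_{i₁}, …, K_{iₙ})` for all `tᵢ ≥ 0`.
By `IsMixedVolumeFunction.eq_mixedVolume` below, such a function is equal to `mixedVolume`. -/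
structure IsMixedVolumeFunction {n : ℕ}
    (M : (Fin n → Set (EuclideanSpace ℝ (Fin n))) → ℝ) : Prop where
  nonneg : ∀ K : Fin n → Set (EuclideanSpace ℝ (Fin n)),
    (∀ i, (K i).Nonempty ∧ IsCompact (K i) ∧ Convex ℝ (K i)) → 0 ≤ M K
  symm : ∀ K : Fin n → Set (EuclideanSpace ℝ (Fin n)),
    (∀ i, (K i).Nonempty ∧ IsCompact (K i) ∧ Convex ℝ (K i)) →
    ∀ σ : Equiv.Perm (Fin n), M (fun i => K (σ i)) = M K
  volume_sum : ∀ K : Fin n → Set (EuclideanSpace ℝ (Fin n)),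
    (∀ i, (K i).Nonempty ∧ IsCompact (K i) ∧ Convex ℝ (K i)) →
    ∀ t : Fin n → ℝ, (∀ i, 0 ≤ t i) →
    (volume (∑ i, t i • K i)).toReal =
      ∑ f : Fin n → Fin n, (∏ k, t (f k)) * M (fun k => K (f k))

theorem IsMixedVolumeFunction.eq_mixedVolume {n : ℕ}
    {M : (Fin n → Set (EuclideanSpace ℝ (Fin n))) → ℝ} (hM : IsMixedVolumeFunction M)
    (K : Fin n → Set (EuclideanSpace ℝ (Fin n)))
    (hK : ∀ i, (K i).Nonempty ∧ IsCompact (K i) ∧ Convex ℝ (K i)) :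
    M K = mixedVolume K := by
  classical
  have h1 : ∀ S : Finset (Fin n), (volume (∑ i ∈ S, K i)).toReal =
      ∑ f : Fin n → Fin n, (if ∀ k, f k ∈ S then (1 : ℝ) else 0) * M (fun k => K (f k)) := by
    intro S
    have h := hM.volume_sum K hK (fun i => if i ∈ S then 1 else 0)
      (fun i => by split_ifs <;> norm_num)
    have e : ∑ i, (if i ∈ S then (1 : ℝ) else 0) • K i = ∑ i ∈ S, K i := by
      rw [← Finset.sum_subset (Finset.subset_univ S)]
      · exact Finset.sum_congr rfl (fun i hi => by simp [hi])
      · intro i _ hi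
        simp only [hi, if_false]
        exact Set.zero_smul_set (hK i).1
    rw [e] at h
    rw [h]
    refine Finset.sum_congr rfl (fun f _ => ?_)
    congr 1
    rw [Finset.prod_ite_zero]
    simp
  have h2 : ∀ f : Fin n → Fin n,
      ∑ S : Finset (Fin n), (-1 : ℝ) ^ (n - S.card) * (if ∀ k, f k ∈ S then (1 : ℝ) else 0) =
        if Function.Bijective f then 1 else 0 := by
    intro f
    have e1 : ∑ S : Finset (Fin n),
        (-1 : ℝ) ^ (n - S.card) * (if ∀ k, f k ∈ S then (1 : ℝ) else 0) =
        ∑ T : Finset (Fin n), if T ⊆ (Finset.univ.image f)ᶜ then (-1 : ℝ) ^ T.card else 0 := by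
      refine Fintype.sum_equiv (compl_involutive.toPerm _) _ _ (fun S => ?_)
      have c : (∀ k, f k ∈ S) ↔ Sᶜ ⊆ (Finset.univ.image f)ᶜ := by
        rw [Finset.compl_subset_compl, Finset.image_subset_iff]
        simp
      change _ = if Sᶜ ⊆ _ then (-1 : ℝ) ^ (Sᶜ).card else 0
      rw [Finset.card_compl, Fintype.card_fin]
      by_cases hc : ∀ k, f k ∈ S
      · rw [if_pos hc, if_pos (c.1 hc), mul_one]
      · rw [if_neg hc, if_neg (fun h => hc (c.2 h)), mul_zero]
    rw [e1, ← Finset.sum_filter]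
    have e2 : Finset.univ.filter (fun T => T ⊆ (Finset.univ.image f)ᶜ) =
        ((Finset.univ.image f)ᶜ).powerset := by
      ext T; simp
    rw [e2]
    have e3 := Finset.sum_powerset_neg_one_pow_card (x := (Finset.univ.image f)ᶜ)
    have e4 : ∑ T ∈ ((Finset.univ.image f)ᶜ).powerset, (-1 : ℝ) ^ T.card =
        ((∑ T ∈ ((Finset.univ.image f)ᶜ).powerset, (-1 : ℤ) ^ T.card : ℤ) : ℝ) := by
      push_cast; rfl
    rw [e4, e3]
    have e5 : (Finset.univ.image f)ᶜ = ∅ ↔ Function.Bijective f := by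
      rw [Finset.compl_eq_empty_iff, ← Finite.surjective_iff_bijective, Finset.eq_univ_iff_forall]
      simp [Function.Surjective]
    by_cases hb : Function.Bijective f
    · rw [if_pos hb, if_pos (e5.2 hb)]; norm_num
    · rw [if_neg hb, if_neg (fun h => hb (e5.1 h))]; norm_num
  have h3 : ∑ f : Fin n → Fin n, (if Function.Bijective f then (1 : ℝ) else 0) *
      M (fun k => K (f k)) = n.factorial * M K := by
    have e1 : ∀ f : Fin n → Fin n, (if Function.Bijective f then (1 : ℝ) else 0) *
        M (fun k => K (f k)) = if Function.Bijective f then M K else 0 := by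
      intro f
      by_cases hb : Function.Bijective f
      · rw [if_pos hb, if_pos hb, one_mul]
        exact hM.symm K hK (Equiv.ofBijective f hb)
      · rw [if_neg hb, if_neg hb, zero_mul]
    rw [Finset.sum_congr rfl (fun f _ => e1 f), ← Finset.sum_filter, Finset.sum_const,
      nsmul_eq_mul]
    congr 2
    rw [← Fintype.card_subtype,
      ← Fintype.card_congr (Equiv.ofBijective
        (fun σ : Equiv.Perm (Fin n) => (⟨σ, σ.bijective⟩ : {f : Fin n → Fin n // f.Bijective}))
        ⟨fun a b h => Equiv.ext (fun x => congrFun (Subtype.ext_iff.1 h) x),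
         fun f => ⟨Equiv.ofBijective f.1 f.2, rfl⟩⟩),
      Fintype.card_perm, Fintype.card_fin]
  have hn : (n.factorial : ℝ) ≠ 0 := by exact_mod_cast n.factorial_ne_zero
  unfold mixedVolume
  rw [eq_inv_mul_iff_mul_eq₀ hn, ← h3]
  simp_rw [h1, Finset.mul_sum]
  rw [Finset.sum_comm]
  refine Finset.sum_congr rfl (fun f _ => ?_)
  rw [← h2 f, Finset.sum_mul]
  exact Finset.sum_congr rfl (fun S _ => by ring)

/-- `MV_j(G, K) = MV(G, …, G, K, …, K)` with `n - j` copies of `G` and `j` copies of `K`. -/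
noncomputable def mixedVolumePair {n : ℕ} (j : ℕ) (G K : Set (EuclideanSpace ℝ (Fin n))) : ℝ :=
  mixedVolume (fun i : Fin n => if (i : ℕ) < n - j then G else K)

/-- `𝒦(G)`: the nonempty compact convex subsets of `G`. -/
def compactConvexSubsets {n : ℕ} (G : Set (EuclideanSpace ℝ (Fin n))) :
    Set (Set (EuclideanSpace ℝ (Fin n))) :=
  {K | K.Nonempty ∧ IsCompact K ∧ Convex ℝ K ∧ K ⊆ G}

/-- `d_G(K, L) = ∑_{j = 1}^{n} (2 MV_j(G, K ∪̃ L) - MV_j(G, K) - MV_j(G, L))`, where `K ∪̃ L` is the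
closed convex hull of `K ∪ L`. (The term for `j = 0` would be zero.) -/
noncomputable def quasiDist {n : ℕ} (G K L : Set (EuclideanSpace ℝ (Fin n))) : ℝ :=
  ∑ j ∈ Finset.Icc 1 n, (2 * mixedVolumePair j G (closedConvexHull ℝ (K ∪ L)) -
    mixedVolumePair j G K - mixedVolumePair j G L)

/-- A convex polytope: the convex hull of finitely many points. -/
def IsConvexPolytope {n : ℕ} (G : Set (EuclideanSpace ℝ (Fin n))) : Prop :=
  ∃ s : Finset (EuclideanSpace ℝ (Fin n)), G = convexHull ℝ (s : Set (EuclideanSpace ℝ (Fin n)))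

/-! All three parts are tested on pairs `K ⊆ G`, `L = G`. The hull is then `G`, so `quasiDist G K G`
is the sum of `Vol G - MV_j(G, K)`. For 1, `K` is `G` shrunk by the factor `1 - t` towards one of
its points. Its mixed volumes are `(1 - t) ^ j * Vol G`, so the quasi-distance is at least `t * Vol
G`, while the Hausdorff distance is `O(t)`. For 2 and 3, `K` is `G` with a small cap cut off at a
point `v` farthest from the origin. The Hausdorff distance is at least `ε / ‖v‖`, whereas
`quasiDist_le_volume_sub` bounds the quasi-distance by a constant times the cap volume. That volume
is `O(ε ^ ((n + 1) / 2))` because `G` lies in the ball of radius `‖v‖` (`toReal_volume_cap_le`), and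
`O(ε ^ n)` for a polytope because it lies in a pointed cone at `v`
(`exists_toReal_volume_polytope_cap_le`). -/

open scoped RealInnerProductSpace

/-! ### Mixed volumes of homothetic copies. -/

/-- The polarization identity for the power `x ↦ x ^ n`. -/
theorem sum_neg_one_pow_mul_sum_pow {n : ℕ} (c : Fin n → ℝ) :
    ∑ S : Finset (Fin n), (-1 : ℝ) ^ (n - S.card) * (∑ i ∈ S, c i) ^ n =
      n.factorial * ∏ i, c i := by
  classical
  have h1 : ∀ S : Finset (Fin n), (∑ i ∈ S, c i) ^ n =
      ∑ f : Fin n → Fin n, (if ∀ k, f k ∈ S then (1 : ℝ) else 0) * ∏ k, c (f k) := by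
    intro S
    have e : (∑ i ∈ S, c i) ^ n = ∏ _k : Fin n, ∑ i, (if i ∈ S then c i else 0) := by
      simp [Finset.sum_ite_mem]
    rw [e, Finset.prod_univ_sum]
    refine Finset.sum_congr (by ext; simp) fun f _ => ?_
    rw [Finset.prod_ite_zero]
    simp
  -- Inclusion–exclusion over the sets `S` containing the range of `f`: the signs cancel unless `f`
  -- is surjective, hence bijective.
  have h2 : ∀ f : Fin n → Fin n,
      ∑ S : Finset (Fin n), (-1 : ℝ) ^ (n - S.card) * (if ∀ k, f k ∈ S then (1 : ℝ) else 0) =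
        if Function.Bijective f then 1 else 0 := by
    intro f
    have e1 : ∑ S : Finset (Fin n),
        (-1 : ℝ) ^ (n - S.card) * (if ∀ k, f k ∈ S then (1 : ℝ) else 0) =
        ∑ T ∈ ((Finset.univ.image f)ᶜ).powerset, (-1 : ℝ) ^ T.card := by
      rw [← Finset.filter_subset_univ, Finset.sum_filter]
      refine Fintype.sum_equiv (compl_involutive.toPerm _) _ _ fun S => ?_
      have c : (∀ k, f k ∈ S) ↔ Sᶜ ⊆ (Finset.univ.image f)ᶜ := by
        rw [Finset.compl_subset_compl, Finset.image_subset_iff]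
        simp
      change _ = if Sᶜ ⊆ _ then (-1 : ℝ) ^ (Sᶜ).card else 0
      rw [Finset.card_compl, Fintype.card_fin]
      simp [c]
    have e2 := congrArg (Int.cast : ℤ → ℝ)
      (Finset.sum_powerset_neg_one_pow_card (x := (Finset.univ.image f)ᶜ))
    push_cast at e2
    have e3 : (Finset.univ.image f)ᶜ = ∅ ↔ Function.Bijective f := by
      rw [Finset.compl_eq_empty_iff, ← Finite.surjective_iff_bijective, Finset.eq_univ_iff_forall]
      simp [Function.Surjective]
    rw [e1, e2]
    simp [e3]
  have h3 : ∀ f : Fin n → Fin n, (if Function.Bijective f then (1 : ℝ) else 0) * ∏ k, c (f k) =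
      (if Function.Bijective f then (1 : ℝ) else 0) * ∏ k, c k := by
    intro f
    split_ifs with hb
    · rw [show ∏ k, c (f k) = ∏ k, c k from (Equiv.ofBijective f hb).prod_comp c]
    · simp
  have h4 : ∑ f : Fin n → Fin n, (if Function.Bijective f then (1 : ℝ) else 0) =
      n.factorial := by
    rw [← Finset.sum_filter, Finset.sum_const, nsmul_one, ← Fintype.card_subtype,
      ← Fintype.card_congr (Equiv.ofBijective
        (fun σ : Equiv.Perm (Fin n) => (⟨σ, σ.bijective⟩ : {f : Fin n → Fin n // f.Bijective}))
        ⟨fun a b h => Equiv.ext fun x => congrFun (Subtype.ext_iff.1 h) x,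
         fun f => ⟨Equiv.ofBijective f.1 f.2, rfl⟩⟩),
      Fintype.card_perm, Fintype.card_fin]
  rw [← h4, Finset.sum_mul]
  simp_rw [← h3, h1, Finset.mul_sum]
  rw [Finset.sum_comm]
  refine Finset.sum_congr rfl fun f _ => ?_
  rw [← h2 f, Finset.sum_mul]
  exact Finset.sum_congr rfl fun S _ => by ring

/-- Convexity gives `a • G + b • G = (a + b) • G` for `a, b ≥ 0`; nonemptiness gives `0 • G = {0}`
for the empty sum. -/
theorem Convex.sum_smul_add_singleton {E ι : Type*} [AddCommGroup E] [Module ℝ E] {G : Set E}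
    (hG : Convex ℝ G) (hne : G.Nonempty) (s : Finset ι) {c : ι → ℝ} (hc : ∀ i, 0 ≤ c i)
    (x : ι → E) :
    ∑ i ∈ s, (c i • G + {x i}) = (∑ i ∈ s, c i) • G + {∑ i ∈ s, x i} := by
  classical
  induction s using Finset.induction_on with
  | empty => simp [Set.zero_smul_set hne, Set.singleton_zero]
  | insert a s ha ih =>
    rw [Finset.sum_insert ha, Finset.sum_insert ha, Finset.sum_insert ha, ih,
      hG.add_smul (hc a) (Finset.sum_nonneg fun i _ => hc i), ← Set.singleton_add_singleton]
    abel

theorem Convex.sum_const_eq_smul {E ι : Type*} [AddCommGroup E] [Module ℝ E] {G : Set E}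
    (hG : Convex ℝ G) (hne : G.Nonempty) (s : Finset ι) :
    ∑ _i ∈ s, G = (s.card : ℝ) • G := by
  have := hG.sum_smul_add_singleton hne s (c := fun _ => 1) (fun _ => zero_le_one) (fun _ => 0)
  simpa using this

section

variable {n : ℕ} {G K : Set (EuclideanSpace ℝ (Fin n))}

theorem toReal_volume_smul_add_singleton (G : Set (EuclideanSpace ℝ (Fin n))) {c : ℝ} (hc : 0 ≤ c)
    (x : EuclideanSpace ℝ (Fin n)) :
    (volume (c • G + {x})).toReal = c ^ n * (volume G).toReal := by
  rw [Set.add_singleton, Set.image_add_right, measure_preimage_add_right, Measure.addHaar_smul,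
    ENNReal.toReal_mul, finrank_euclideanSpace_fin, abs_of_nonneg (pow_nonneg hc n),
    ENNReal.toReal_ofReal (pow_nonneg hc n)]

theorem toReal_volume_smul (G : Set (EuclideanSpace ℝ (Fin n))) {c : ℝ} (hc : 0 ≤ c) :
    (volume (c • G)).toReal = c ^ n * (volume G).toReal := by
  simpa using toReal_volume_smul_add_singleton G hc 0

/-- The mixed volume of translated dilates of a convex set. -/
theorem mixedVolume_smul_add_singleton (hG : Convex ℝ G) (hne : G.Nonempty) {c : Fin n → ℝ}
    (hc : ∀ i, 0 ≤ c i) (x : Fin n → EuclideanSpace ℝ (Fin n)) :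
    mixedVolume (fun i => c i • G + {x i}) = (∏ i, c i) * (volume G).toReal := by
  have h0 : (n.factorial : ℝ) ≠ 0 := by exact_mod_cast n.factorial_ne_zero
  unfold mixedVolume
  rw [inv_mul_eq_iff_eq_mul₀ h0, ← mul_assoc, ← sum_neg_one_pow_mul_sum_pow, Finset.sum_mul]
  refine Finset.sum_congr rfl fun S _ => ?_
  rw [hG.sum_smul_add_singleton hne S hc,
    toReal_volume_smul_add_singleton G (Finset.sum_nonneg fun i _ => hc i)]
  ring

theorem mixedVolume_const (hG : Convex ℝ G) (hne : G.Nonempty) :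
    mixedVolume (fun _ : Fin n => G) = (volume G).toReal := by
  have := mixedVolume_smul_add_singleton hG hne (c := fun _ : Fin n => 1)
    (fun _ => zero_le_one) (fun _ => 0)
  simpa using this

theorem mixedVolumePair_homothety (hG : Convex ℝ G) (hne : G.Nonempty) {c : ℝ} (hc : 0 ≤ c)
    (x : EuclideanSpace ℝ (Fin n)) {j : ℕ} (hj : j ≤ n) :
    mixedVolumePair j G (c • G + {x}) = c ^ j * (volume G).toReal := by
  have h := mixedVolume_smul_add_singleton hG hne
    (c := fun i : Fin n => if (i : ℕ) < n - j then 1 else c)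
    (fun i => by split_ifs <;> simp [hc]) (fun i => if (i : ℕ) < n - j then 0 else x)
  have e : (∏ i : Fin n, if (i : ℕ) < n - j then (1 : ℝ) else c) = c ^ j := by
    rw [Fin.prod_univ_eq_prod_range (fun i => if i < n - j then (1 : ℝ) else c) n,
      ← Finset.prod_range_mul_prod_Ico _ (Nat.sub_le n j),
      Finset.prod_congr rfl (g := fun _ => (1 : ℝ))
        (fun i hi => if_pos (Finset.mem_range.1 hi)),
      Finset.prod_congr (s₁ := Finset.Ico (n - j) n) rfl (g := fun _ => c)
        (fun i hi => if_neg (not_lt.2 (Finset.mem_Ico.1 hi).1))]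
    simp [Nat.sub_sub_self hj]
  rw [← e, ← h]
  unfold mixedVolumePair
  congr 1
  funext i
  split_ifs <;> simp

theorem mixedVolumePair_self (hG : Convex ℝ G) (hne : G.Nonempty) (j : ℕ) :
    mixedVolumePair j G G = (volume G).toReal := by
  simpa [mixedVolumePair] using mixedVolume_const hG hne

/-! ### Quasi-distance from a subset to `G`, bounded by lost volume. -/

theorem closedConvexHull_union_eq (hG : Convex ℝ G) (hc : IsClosed G) (hK : K ⊆ G) :
    closedConvexHull ℝ (K ∪ G) = G := by
  rw [Set.union_eq_right.2 hK]
  exact (closedConvexHull_min subset_rfl hG hc).antisymm subset_closedConvexHull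

theorem quasiDist_eq_of_subset (hG : Convex ℝ G) (hne : G.Nonempty) (hc : IsClosed G)
    (hK : K ⊆ G) :
    quasiDist G K G = ∑ j ∈ Finset.Icc 1 n, ((volume G).toReal - mixedVolumePair j G K) := by
  unfold quasiDist
  rw [closedConvexHull_union_eq hG hc hK]
  refine Finset.sum_congr rfl fun j _ => ?_
  rw [mixedVolumePair_self hG hne]
  ring

/-- In the polarization formula each Minkowski sum over `S` lies between `|S| • K` and `|S| • G`, so
replacing it by `|S| • G` changes the volume by at most `|S| ^ n * (Vol G - Vol K)`. There are `2 ^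
n` sets `S`, and `1 / n! ≤ 1`. Absolute values absorb the signs, so monotonicity of mixed volumes is
not needed. -/
theorem abs_volume_sub_mixedVolumePair_le (hG : Convex ℝ G) (hGc : IsCompact G)
    (hK : Convex ℝ K) (hKne : K.Nonempty) (hKG : K ⊆ G) (j : ℕ) :
    |(volume G).toReal - mixedVolumePair j G K| ≤
      2 ^ n * n ^ n * ((volume G).toReal - (volume K).toReal) := by
  have hne : G.Nonempty := hKne.mono hKG
  have hfac : (1 : ℝ) ≤ n.factorial := by exact_mod_cast n.factorial_pos
  have hle : (volume K).toReal ≤ (volume G).toReal :=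
    ENNReal.toReal_mono hGc.measure_lt_top.ne (measure_mono hKG)
  conv_lhs => rw [← mixedVolume_const hG hne]
  unfold mixedVolumePair mixedVolume
  rw [← mul_sub, ← Finset.sum_sub_distrib, abs_mul, abs_of_nonneg (by positivity)]
  refine (mul_le_of_le_one_left (abs_nonneg _) (inv_le_one_of_one_le₀ hfac)).trans ?_
  refine (Finset.abs_sum_le_sum_abs _ _).trans ?_
  have hterm : ∀ S ∈ (Finset.univ : Finset (Finset (Fin n))),
      |(-1 : ℝ) ^ (n - S.card) * (volume (∑ _i ∈ S, G)).toReal - (-1 : ℝ) ^ (n - S.card) *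
        (volume (∑ i ∈ S, if (i : ℕ) < n - j then G else K)).toReal| ≤
      n ^ n * ((volume G).toReal - (volume K).toReal) := by
    intro S _
    have hS : (S.card : ℝ) ≤ n := by exact_mod_cast (Finset.card_le_univ S).trans_eq (by simp)
    have hsub : (∑ i ∈ S, if (i : ℕ) < n - j then G else K) ⊆ (S.card : ℝ) • G := by
      rw [← hG.sum_const_eq_smul hne]
      refine Set.finsetSum_subset_finsetSum _ _ _ fun i _ => ?_
      split_ifs
      exacts [subset_rfl, hKG]
    have hsup : (S.card : ℝ) • K ⊆ ∑ i ∈ S, if (i : ℕ) < n - j then G else K := by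
      rw [← hK.sum_const_eq_smul hKne]
      refine Set.finsetSum_subset_finsetSum _ _ _ fun i _ => ?_
      split_ifs
      exacts [hKG, subset_rfl]
    have hfin : volume ((S.card : ℝ) • G) ≠ ⊤ := (hGc.smul _).measure_lt_top.ne
    have h1 := ENNReal.toReal_mono hfin (measure_mono hsub)
    have h2 := ENNReal.toReal_mono (measure_ne_top_of_subset hsub hfin) (measure_mono hsup)
    rw [toReal_volume_smul _ (Nat.cast_nonneg _)] at h1 h2
    rw [hG.sum_const_eq_smul hne, toReal_volume_smul _ (Nat.cast_nonneg _), ← mul_sub, abs_mul,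
      abs_pow, abs_neg, abs_one, one_pow, one_mul, abs_of_nonneg (sub_nonneg.2 h1)]
    calc _ ≤ (S.card : ℝ) ^ n * ((volume G).toReal - (volume K).toReal) := by linarith
      _ ≤ _ := by
        gcongr
  refine (Finset.sum_le_card_nsmul _ _ _ hterm).trans_eq ?_
  simp [mul_assoc]

theorem quasiDist_le_volume_sub (hG : Convex ℝ G) (hGc : IsCompact G)
    (hK : Convex ℝ K) (hKne : K.Nonempty) (hKG : K ⊆ G) :
    quasiDist G K G ≤ n * (2 ^ n * n ^ n) * ((volume G).toReal - (volume K).toReal) := by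
  rw [quasiDist_eq_of_subset hG (hKne.mono hKG) hGc.isClosed hKG]
  refine (Finset.sum_le_card_nsmul _ _ _ fun j _ =>
    (le_abs_self _).trans (abs_volume_sub_mixedVolumePair_le hG hGc hK hKne hKG j)).trans_eq ?_
  simp [mul_assoc]

end

/-! ### Sharpness of the upper exponent. -/

section

variable {n : ℕ} {G : Set (EuclideanSpace ℝ (Fin n))}

theorem not_quasiDist_le_rpow (hn : 1 ≤ n) (hG : Convex ℝ G) (hGc : IsCompact G)
    (hGint : (interior G).Nonempty) {β : ℝ} (hβ : 1 < β) :
    ¬ ∃ C : ℝ, 0 < C ∧ ∀ K ∈ compactConvexSubsets G, ∀ L ∈ compactConvexSubsets G,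
      quasiDist G K L ≤ C * Metric.hausdorffDist K L ^ β := by
  rintro ⟨C, hC, h⟩
  have hne : G.Nonempty := hGint.mono interior_subset
  obtain ⟨x, hx⟩ := hne
  have hV : 0 < (volume G).toReal :=
    ENNReal.toReal_pos (Measure.measure_pos_of_nonempty_interior _ hGint).ne' hGc.measure_lt_top.ne
  set V := (volume G).toReal
  -- The added `1` makes positivity immediate.
  set D := Metric.diam G + 1
  have hD : 0 < D := by have := Metric.diam_nonneg (s := G); positivity
  have key : ∀ t : ℝ, 0 < t → t < 1 → V ≤ C * D ^ β * t ^ (β - 1) := by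
    intro t ht ht1
    have ht1' : 0 ≤ 1 - t := by linarith
    set K := (1 - t) • G + {t • x}
    have hmem : ∀ g ∈ G, (1 - t) • g + t • x ∈ K := fun g hg =>
      Set.add_mem_add (Set.smul_mem_smul_set hg) rfl
    have hKG : K ⊆ G := by
      rintro _ ⟨_, ⟨g, hg, rfl⟩, _, rfl, rfl⟩
      exact hG hg hx ht1' ht.le (by ring)
    have hK : K ∈ compactConvexSubsets G :=
      ⟨⟨_, hmem x hx⟩, (hGc.smul _).add isCompact_singleton,
        (hG.smul _).add (convex_singleton _), hKG⟩
    have hd := h K hK G ⟨⟨x, hx⟩, hGc, hG, subset_rfl⟩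
    rw [quasiDist_eq_of_subset hG ⟨x, hx⟩ hGc.isClosed hKG] at hd
    -- The term `j = 1` equals `t * V`; the others are nonnegative.
    have hlow : t * V ≤ ∑ j ∈ Finset.Icc 1 n, (V - mixedVolumePair j G K) := by
      have e : ∀ j ∈ Finset.Icc 1 n, V - mixedVolumePair j G K = (1 - (1 - t) ^ j) * V := by
        intro j hj
        rw [mixedVolumePair_homothety hG ⟨x, hx⟩ ht1' (t • x) (Finset.mem_Icc.1 hj).2]
        ring
      rw [Finset.sum_congr rfl e]
      refine le_trans (by simp) (Finset.single_le_sum (f := fun j => (1 - (1 - t) ^ j) * V)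
        (fun j _ => mul_nonneg (sub_nonneg.2 (pow_le_one₀ ht1' (by linarith))) hV.le)
        (Finset.mem_Icc.2 ⟨le_rfl, hn⟩))
    have hdist : ∀ g ∈ G, dist ((1 - t) • g + t • x) g ≤ t * D := by
      intro g hg
      have e : (1 - t) • g + t • x - g = t • (x - g) := by module
      rw [dist_eq_norm, e, norm_smul, Real.norm_of_nonneg ht.le, ← dist_eq_norm]
      have := Metric.dist_le_diam_of_mem hGc.isBounded hx hg
      gcongr
      exact this.trans (by simp [D])
    have hH : Metric.hausdorffDist K G ≤ t * D := by
      refine Metric.hausdorffDist_le_of_mem_dist (by positivity) ?_ ?_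
      · rintro _ ⟨_, ⟨g, hg, rfl⟩, _, rfl, rfl⟩
        exact ⟨g, hg, hdist g hg⟩
      · intro g hg
        exact ⟨_, hmem g hg, by rw [dist_comm]; exact hdist g hg⟩
    have h1 : t * V ≤ C * (t * D) ^ β :=
      hlow.trans (hd.trans (mul_le_mul_of_nonneg_left
        (Real.rpow_le_rpow Metric.hausdorffDist_nonneg hH (by linarith)) hC.le))
    rw [Real.mul_rpow ht.le hD.le] at h1
    rw [Real.rpow_sub_one ht.ne', ← mul_div_assoc, le_div_iff₀ ht]
    linarith
  have hlim : Filter.Tendsto (fun t : ℝ => C * D ^ β * t ^ (β - 1)) (nhdsWithin 0 (Set.Ioi 0))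
      (nhds (C * D ^ β * 0 ^ (β - 1))) :=
    ((Real.continuousAt_rpow_const 0 (β - 1) (Or.inr (by linarith))).tendsto.mono_left
      nhdsWithin_le_nhds).const_mul _
  rw [Real.zero_rpow (by linarith), mul_zero] at hlim
  have := ge_of_tendsto hlim (by
    filter_upwards [Ioo_mem_nhdsGT (zero_lt_one (α := ℝ))] with t ht
    exact key t ht.1 ht.2)
  linarith

/-! ### Lower exponents from cutting off caps. -/

/-- If the caps of height `ε` of `G` at a farthest point `v` from the origin have volume
`O(ε ^ q)`, then `quasiDist G` has no lower bound of order `p < q` in the Hausdorff distance. -/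
theorem not_rpow_le_quasiDist_of_cap (hG : Convex ℝ G) (hGc : IsCompact G)
    {v w : EuclideanSpace ℝ (Fin n)} (hv : v ∈ G) (hv0 : v ≠ 0) (hvG : ∀ x ∈ G, ‖x‖ ≤ ‖v‖)
    (hw : w ∈ G) (hwv : w ≠ v) {A q : ℝ} (hq : 0 < q)
    (hcap : ∀ ε : ℝ, 0 < ε → ε < 1 →
      (volume {x ∈ G | ‖v‖ ^ 2 - ε ≤ ⟪v, x⟫}).toReal ≤ A * ε ^ q) {p : ℝ} (hp : p < q) :
    ¬ ∃ C : ℝ, 0 < C ∧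
      ∀ K ∈ compactConvexSubsets G, ∀ L ∈ compactConvexSubsets G, K ≠ L →
        C * Metric.hausdorffDist K L ^ p ≤ quasiDist G K L := by
  rintro ⟨C, hC, h⟩
  have hR : 0 < ‖v‖ := norm_pos_iff.2 hv0
  -- Expanding `0 < ‖v - w‖ ^ 2` with `‖w‖ ≤ ‖v‖` gives strictness. Hence `w` survives the cut for
  -- small `ε`, which keeps `K` nonempty.
  have hwlt : ⟪v, w⟫ < ‖v‖ ^ 2 := by
    have h1 := norm_sub_sq_real v w
    have h2 : 0 < ‖v - w‖ := norm_pos_iff.2 (sub_ne_zero.2 hwv.symm)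
    have h3 := hvG w hw
    have h4 : ‖w‖ ^ 2 ≤ ‖v‖ ^ 2 := by gcongr
    nlinarith [pow_pos h2 2]
  set D := Metric.diam G
  set B : ℝ := n * (2 ^ n * n ^ n)
  have hB : 0 ≤ B := by positivity
  have main : ∀ ε : ℝ, 0 < ε → ε < 1 → ε < ‖v‖ ^ 2 - ⟪v, w⟫ →
      ∃ d : ℝ, ε / ‖v‖ ≤ d ∧ d ≤ D ∧ C * d ^ p ≤ B * A * ε ^ q := by
    intro ε hε hε1 hεw
    set K := {x ∈ G | ⟪v, x⟫ ≤ ‖v‖ ^ 2 - ε}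
    have hKG : K ⊆ G := Set.sep_subset _ _
    have hKne : K.Nonempty := ⟨w, hw, by linarith⟩
    have hKclosed : IsClosed {x : EuclideanSpace ℝ (Fin n) | ⟪v, x⟫ ≤ ‖v‖ ^ 2 - ε} :=
      isClosed_le (by fun_prop) continuous_const
    have hKc : IsCompact K := hGc.inter_right hKclosed
    have hK : Convex ℝ K := hG.inter (convex_halfSpace_le (innerₛₗ ℝ v).isLinear _)
    have hlow : ε / ‖v‖ ≤ Metric.hausdorffDist K G := by
      have hfin : Metric.hausdorffEDist G K ≠ ⊤ :=
        Metric.hausdorffEDist_ne_top_of_nonempty_of_bounded ⟨v, hv⟩ hKne hGc.isBounded hKc.isBounded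
      rw [Metric.hausdorffDist_comm]
      refine le_trans ?_ (Metric.infDist_le_hausdorffDist_of_mem hv hfin)
      -- By Cauchy–Schwarz, `ε ≤ ⟪v, v - y⟫ ≤ ‖v‖ * ‖v - y‖` for every `y ∈ K`.
      refine (Metric.le_infDist hKne).2 fun y hy => ?_
      rw [div_le_iff₀ hR, dist_eq_norm, mul_comm]
      have h1 := real_inner_le_norm v (v - y)
      rw [inner_sub_right, real_inner_self_eq_norm_sq] at h1
      have h2 : ⟪v, y⟫ ≤ ‖v‖ ^ 2 - ε := hy.2
      linarith
    have hup : Metric.hausdorffDist K G ≤ D := by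
      have := Metric.hausdorffDist_le_diam hKne hKc.isBounded ⟨v, hv⟩ hGc.isBounded
      rwa [Set.union_eq_right.2 hKG] at this
    refine ⟨_, hlow, hup, ?_⟩
    have hneq : K ≠ G := by
      intro e
      rw [e, Metric.hausdorffDist_self_zero] at hlow
      have : 0 < ε / ‖v‖ := by positivity
      linarith
    refine (h K ⟨hKne, hKc, hK, hKG⟩ G ⟨⟨v, hv⟩, hGc, hG, subset_rfl⟩ hneq).trans ?_
    refine (quasiDist_le_volume_sub hG hGc hK hKne hKG).trans ?_
    rw [mul_assoc B]
    refine mul_le_mul_of_nonneg_left ?_ hB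
    refine le_trans ?_ (hcap ε hε hε1)
    set U := {x ∈ G | ‖v‖ ^ 2 - ε ≤ ⟪v, x⟫}
    have hsub : G ⊆ K ∪ U := fun x hx => (le_total ⟪v, x⟫ (‖v‖ ^ 2 - ε)).imp
      (fun h => ⟨hx, h⟩) (fun h => ⟨hx, h⟩)
    have hU : volume U ≠ ⊤ := measure_ne_top_of_subset (Set.sep_subset _ _) hGc.measure_lt_top.ne
    have := ENNReal.toReal_mono (ENNReal.add_ne_top.2 ⟨hKc.measure_lt_top.ne, hU⟩)
      ((measure_mono hsub).trans (measure_union_le K U))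
    rw [ENNReal.toReal_add hKc.measure_lt_top.ne hU] at this
    linarith
  have hev : ∀ᶠ ε in nhdsWithin (0 : ℝ) (Set.Ioi 0),
      0 < ε ∧ ε < 1 ∧ ε < ‖v‖ ^ 2 - ⟪v, w⟫ := by
    filter_upwards [Ioo_mem_nhdsGT (zero_lt_one (α := ℝ)), Ioo_mem_nhdsGT (sub_pos.2 hwlt)]
      with ε h1 h2
    exact ⟨h1.1, h1.2, h2.2⟩
  have hlim : ∀ r : ℝ, 0 < r → Filter.Tendsto (fun ε : ℝ => B * A * ε ^ r)
      (nhdsWithin 0 (Set.Ioi 0)) (nhds 0) := by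
    intro r hr
    have : Filter.Tendsto (fun ε : ℝ => B * A * ε ^ r) (nhdsWithin 0 (Set.Ioi 0))
        (nhds (B * A * 0 ^ r)) :=
      ((Real.continuousAt_rpow_const 0 r (Or.inr hr.le)).tendsto.mono_left
        nhdsWithin_le_nhds).const_mul _
    rwa [Real.zero_rpow hr.ne', mul_zero] at this
  -- For `p ≥ 0` the lower bound on `d` bounds `d ^ p` from below; for `p ≤ 0` the power is
  -- decreasing and `d ≤ D` does so instead.
  rcases le_total 0 p with hp0 | hp0
  · have := ge_of_tendsto (hlim (q - p) (sub_pos.2 hp)) (b := C / ‖v‖ ^ p) (by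
      filter_upwards [hev] with ε ⟨h1, h2, h3⟩
      obtain ⟨d, hd1, -, hd⟩ := main ε h1 h2 h3
      have h4 : C * (ε / ‖v‖) ^ p ≤ B * A * ε ^ q :=
        le_trans (mul_le_mul_of_nonneg_left
          (Real.rpow_le_rpow (by positivity) hd1 hp0) hC.le) hd
      rw [Real.div_rpow h1.le hR.le] at h4
      rw [Real.rpow_sub h1, ← mul_div_assoc, le_div_iff₀ (Real.rpow_pos_of_pos h1 p)]
      calc _ = C * (ε ^ p / ‖v‖ ^ p) := by ring
        _ ≤ _ := h4)
    have : 0 < C / ‖v‖ ^ p := by positivity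
    linarith
  · have hDpos : 0 < D := by
      obtain ⟨ε, h1, h2, h3⟩ := hev.exists
      obtain ⟨d, hd1, hd2, -⟩ := main ε h1 h2 h3
      exact (div_pos h1 hR).trans_le (hd1.trans hd2)
    have := ge_of_tendsto (hlim q hq) (b := C * D ^ p) (by
      filter_upwards [hev] with ε ⟨h1, h2, h3⟩
      obtain ⟨d, hd1, hd2, hd⟩ := main ε h1 h2 h3
      exact le_trans (mul_le_mul_of_nonneg_left
        (Real.rpow_le_rpow_of_nonpos ((div_pos h1 hR).trans_le hd1) hd2 hp0) hC.le) hd)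
    have : 0 < C * D ^ p := by positivity
    linarith

/-! ### Volumes of caps at a farthest point. -/

/-- The volume of a slab of half-width `a` intersected with a ball of radius `b`. -/
theorem toReal_volume_slab_inter_ball_le (hn : 1 ≤ n) {u : EuclideanSpace ℝ (Fin n)}
    (hu : ‖u‖ = 1) {a b : ℝ} (ha : 0 ≤ a) (hb : 0 ≤ b) (v : EuclideanSpace ℝ (Fin n)) :
    (volume {x | |⟪u, x - v⟫| ≤ a ∧ ‖x - v‖ ≤ b}).toReal ≤ 2 ^ n * (a * b ^ (n - 1)) := by
  let i₀ : Fin n := ⟨0, hn⟩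
  have ho : Orthonormal ℝ (({i₀} : Set (Fin n)).domRestrict fun _ => u) :=
    ⟨fun _ => hu, fun i j hij => (hij (Subsingleton.elim _ _)).elim⟩
  obtain ⟨e, he⟩ := ho.exists_orthonormalBasis_extension_of_card_eq (by simp)
  have he0 : e i₀ = u := he i₀ rfl
  -- In an orthonormal basis containing `u`, the set fits in a box of half-width `a` along `u` and
  -- `b` along the other axes.
  let c : Fin n → ℝ := fun i => if i = i₀ then a else b
  have hc : ∀ i, 0 ≤ c i := fun i => by dsimp only [c]; split_ifs <;> assumption
  let F : EuclideanSpace ℝ (Fin n) → (Fin n → ℝ) := fun y => WithLp.ofLp (e.repr y)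
  have hF : MeasurePreserving F volume volume :=
    (PiLp.volume_preserving_ofLp (Fin n)).comp e.measurePreserving_repr
  have hsub : {x | |⟪u, x - v⟫| ≤ a ∧ ‖x - v‖ ≤ b} ⊆
      (fun x => x - v) ⁻¹' (F ⁻¹' Set.Icc (-c) c) := by
    rintro x ⟨h1, h2⟩
    have : ∀ i, |F (x - v) i| ≤ c i := by
      intro i
      have hi : F (x - v) i = ⟪e i, x - v⟫ := e.repr_apply_apply _ _
      rw [hi]
      dsimp only [c]
      split_ifs with h
      · rwa [h, he0]
      · refine (abs_real_inner_le_norm _ _).trans ?_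
        rwa [e.orthonormal.1 i, one_mul]
    exact ⟨fun i => (abs_le.1 (this i)).1, fun i => (abs_le.1 (this i)).2⟩
  have hvol : volume ((fun x => x - v) ⁻¹' (F ⁻¹' Set.Icc (-c) c)) = volume (Set.Icc (-c) c) := by
    simp_rw [sub_eq_add_neg]
    rw [measure_preimage_add_right, hF.measure_preimage measurableSet_Icc.nullMeasurableSet]
  refine (ENNReal.toReal_mono ?_ ((measure_mono hsub).trans_eq hvol)).trans_eq ?_
  · exact isCompact_Icc.measure_lt_top.ne
  · rw [Real.volume_Icc_pi_toReal (show -c ≤ c from fun i => neg_le_self (hc i))]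
    have h1 : ∀ i, c i - (-c) i = 2 * c i := fun i => by simp; ring
    simp_rw [h1]
    rw [Finset.prod_mul_distrib, ← Finset.mul_prod_erase _ c (Finset.mem_univ i₀),
      Finset.prod_congr (s₁ := Finset.univ.erase i₀) rfl (g := fun _ => b)
        (fun i hi => if_neg (Finset.ne_of_mem_erase hi))]
    simp [c]

/-- On the cap, `‖x - v‖ ^ 2 ≤ 2 * (‖v‖ ^ 2 - ⟪v, x⟫) ≤ 2 * ε`. The cap thus has thickness of order
`ε` along `v` and `√ε` across, and `1 + (n - 1) / 2 = (n + 1) / 2`. -/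
theorem toReal_volume_cap_le (hn : 1 ≤ n) {v : EuclideanSpace ℝ (Fin n)} (hv0 : v ≠ 0)
    (hvG : ∀ x ∈ G, ‖x‖ ≤ ‖v‖) {ε : ℝ} (hε : 0 < ε) :
    (volume {x ∈ G | ‖v‖ ^ 2 - ε ≤ ⟪v, x⟫}).toReal ≤
      2 ^ n * ‖v‖⁻¹ * √2 ^ (n - 1) * ε ^ (((n : ℝ) + 1) / 2) := by
  have hR : 0 < ‖v‖ := norm_pos_iff.2 hv0
  have hu : ‖‖v‖⁻¹ • v‖ = 1 := norm_smul_inv_norm (𝕜 := ℝ) hv0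
  have hsub : {x ∈ G | ‖v‖ ^ 2 - ε ≤ ⟪v, x⟫} ⊆
      {x | |⟪‖v‖⁻¹ • v, x - v⟫| ≤ ‖v‖⁻¹ * ε ∧ ‖x - v‖ ≤ √2 * √ε} := by
    rintro x ⟨hx, hxv⟩
    have hxR := hvG x hx
    have hsq : ‖x‖ ^ 2 ≤ ‖v‖ ^ 2 := by gcongr
    refine ⟨?_, ?_⟩
    · rw [real_inner_smul_left, abs_mul, abs_of_pos (inv_pos.2 hR), inner_sub_right,
        real_inner_self_eq_norm_sq]
      refine mul_le_mul_of_nonneg_left ?_ (inv_pos.2 hR).le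
      have := real_inner_le_norm v x
      rw [abs_le]
      constructor <;> nlinarith
    · rw [← Real.sqrt_mul zero_le_two]
      refine Real.le_sqrt_of_sq_le ?_
      rw [norm_sub_sq_real, real_inner_comm]
      linarith
  have hfin : volume {x | |⟪‖v‖⁻¹ • v, x - v⟫| ≤ ‖v‖⁻¹ * ε ∧ ‖x - v‖ ≤ √2 * √ε} ≠ ⊤ :=
    measure_ne_top_of_subset (s := Metric.closedBall v (√2 * √ε))
      (by rintro x ⟨-, hx⟩; rwa [Metric.mem_closedBall, dist_eq_norm])
      measure_closedBall_lt_top.ne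
  refine (ENNReal.toReal_mono hfin (measure_mono hsub)).trans ?_
  refine (toReal_volume_slab_inter_ball_le hn hu (by positivity) (by positivity) v).trans_eq ?_
  have e : ε ^ (((n : ℝ) + 1) / 2) = ε * √ε ^ (n - 1) := by
    rw [Real.sqrt_eq_rpow, ← Real.rpow_mul_natCast hε.le, Nat.cast_sub hn]
    nth_rw 2 [← Real.rpow_one ε]
    rw [← Real.rpow_add hε]
    congr 1
    push_cast
    ring
  rw [e, mul_pow]
  ring

/-- At each point of `s` other than `v`, `‖v‖ ^ 2 - ⟪v, x⟫` is positive. As `s` is finite, one `M`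
gives `‖x - v‖ ≤ M * (‖v‖ ^ 2 - ⟪v, x⟫)` on `s`. This condition is convex, so it passes to the hull
and puts the cap in a ball of radius `M * ε`. -/
theorem exists_toReal_volume_polytope_cap_le {s : Finset (EuclideanSpace ℝ (Fin n))}
    {v : EuclideanSpace ℝ (Fin n)} (hvs : ∀ x ∈ s, ‖x‖ ≤ ‖v‖) :
    ∃ A : ℝ, ∀ ε : ℝ, 0 < ε →
      (volume {x ∈ convexHull ℝ (s : Set (EuclideanSpace ℝ (Fin n))) |
        ‖v‖ ^ 2 - ε ≤ ⟪v, x⟫}).toReal ≤ A * ε ^ (n : ℝ) := by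
  have hpt : ∀ x ∈ s, ∃ c : ℝ, 0 ≤ c ∧ ‖x - v‖ ≤ c * (‖v‖ ^ 2 - ⟪v, x⟫) := by
    intro x hx
    rcases eq_or_ne x v with rfl | hxv
    · exact ⟨0, le_rfl, by simp⟩
    · have h1 := norm_sub_sq_real v x
      have h2 : 0 < ‖v - x‖ := norm_pos_iff.2 (sub_ne_zero.2 hxv.symm)
      have h4 : ‖x‖ ^ 2 ≤ ‖v‖ ^ 2 := by gcongr; exact hvs x hx
      have h5 : 0 < ‖v‖ ^ 2 - ⟪v, x⟫ := by nlinarith [pow_pos h2 2]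
      exact ⟨‖x - v‖ / (‖v‖ ^ 2 - ⟪v, x⟫), by positivity, (div_mul_cancel₀ _ h5.ne').ge⟩
  choose! c hc0 hc using hpt
  set M := ∑ x ∈ s, c x
  have hM : 0 ≤ M := Finset.sum_nonneg hc0
  have hinner : ∀ x ∈ s, 0 ≤ ‖v‖ ^ 2 - ⟪v, x⟫ := by
    intro x hx
    have := real_inner_le_norm v x
    have := hvs x hx
    nlinarith [norm_nonneg v]
  have hcone : convexHull ℝ (s : Set (EuclideanSpace ℝ (Fin n))) ⊆
      {x | ‖x - v‖ ≤ M * (‖v‖ ^ 2 - ⟪v, x⟫)} := by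
    refine convexHull_min (fun x hx => (hc x hx).trans ?_) ?_
    · exact mul_le_mul_of_nonneg_right (Finset.single_le_sum hc0 hx) (hinner x hx)
    · intro x hx y hy a b ha hb hab
      simp only [Set.mem_ofPred_eq] at hx hy ⊢
      have e : a • x + b • y - v = a • (x - v) + b • (y - v) := by
        rw [smul_sub, smul_sub, sub_add_sub_comm, ← add_smul, hab, one_smul]
      rw [e, inner_add_right, real_inner_smul_right, real_inner_smul_right]
      calc _ ≤ a * ‖x - v‖ + b * ‖y - v‖ := by
            refine (norm_add_le _ _).trans_eq ?_
            rw [norm_smul, norm_smul, Real.norm_of_nonneg ha, Real.norm_of_nonneg hb]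
        _ ≤ a * (M * (‖v‖ ^ 2 - ⟪v, x⟫)) + b * (M * (‖v‖ ^ 2 - ⟪v, y⟫)) := by gcongr
        _ = M * ((a + b) * ‖v‖ ^ 2 - (a * ⟪v, x⟫ + b * ⟪v, y⟫)) := by ring
        _ = _ := by rw [hab, one_mul]
  refine ⟨M ^ n * (volume (Metric.ball (0 : EuclideanSpace ℝ (Fin n)) 1)).toReal, fun ε hε => ?_⟩
  have hsub : {x ∈ convexHull ℝ (s : Set (EuclideanSpace ℝ (Fin n))) | ‖v‖ ^ 2 - ε ≤ ⟪v, x⟫} ⊆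
      Metric.closedBall v (M * ε) := by
    rintro x ⟨hx, hxv⟩
    rw [Metric.mem_closedBall, dist_eq_norm]
    exact (hcone hx).trans (mul_le_mul_of_nonneg_left (by linarith) hM)
  refine (ENNReal.toReal_mono measure_closedBall_lt_top.ne (measure_mono hsub)).trans_eq ?_
  rw [Measure.addHaar_closedBall _ _ (by positivity), ENNReal.toReal_mul,
    ENNReal.toReal_ofReal (by positivity), finrank_euclideanSpace_fin, Real.rpow_natCast]
  ring

theorem exists_farthest_point (hn : 1 ≤ n) (hGc : IsCompact G) (hGint : (interior G).Nonempty) :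
    ∃ v ∈ G, v ≠ 0 ∧ (∀ x ∈ G, ‖x‖ ≤ ‖v‖) ∧ ∃ w ∈ G, w ≠ v := by
  have : Nonempty (Fin n) := ⟨⟨0, hn⟩⟩
  -- As `n ≥ 1`, the space has no isolated points, so a set with interior is infinite.
  have hnt : G.Nontrivial := by
    obtain ⟨x, hx⟩ := hGint
    exact ((infinite_of_mem_nhds x (isOpen_interior.mem_nhds hx)).mono interior_subset).nontrivial
  obtain ⟨v, hv, hmax⟩ := hGc.exists_isMaxOn hnt.nonempty continuous_norm.continuousOn
  have hmax' : ∀ x ∈ G, ‖x‖ ≤ ‖v‖ := fun x hx => hmax hx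
  obtain ⟨w, hw, hwv⟩ := hnt.exists_ne v
  refine ⟨v, hv, ?_, hmax', w, hw, hwv⟩
  rintro rfl
  exact hwv (norm_le_zero_iff.1 (by simpa using hmax' w hw))

end

theorem theorem3 (n : ℕ) (hn : 1 ≤ n) (G : Set (EuclideanSpace ℝ (Fin n)))
    (hGcompact : IsCompact G) (hGconvex : Convex ℝ G) (hGint : (interior G).Nonempty) :
    (∀ β : ℝ, 1 < β → ¬ ∃ C : ℝ, 0 < C ∧
      ∀ K ∈ compactConvexSubsets G, ∀ L ∈ compactConvexSubsets G,
        quasiDist G K L ≤ C * Metric.hausdorffDist K L ^ β) ∧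
    (∀ p : ℝ, p < ((n : ℝ) + 1) / 2 → ¬ ∃ C : ℝ, 0 < C ∧
      ∀ K ∈ compactConvexSubsets G, ∀ L ∈ compactConvexSubsets G, K ≠ L →
        C * Metric.hausdorffDist K L ^ p ≤ quasiDist G K L) ∧
    (IsConvexPolytope G → ∀ p : ℝ, p < (n : ℝ) → ¬ ∃ C : ℝ, 0 < C ∧
      ∀ K ∈ compactConvexSubsets G, ∀ L ∈ compactConvexSubsets G, K ≠ L →
        C * Metric.hausdorffDist K L ^ p ≤ quasiDist G K L) := by
  obtain ⟨v, hv, hv0, hvG, w, hw, hwv⟩ := exists_farthest_point hn hGcompact hGint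
  refine ⟨fun β hβ => not_quasiDist_le_rpow hn hGconvex hGcompact hGint hβ, fun p hp => ?_, ?_⟩
  · exact not_rpow_le_quasiDist_of_cap hGconvex hGcompact hv hv0 hvG hw hwv (by positivity)
      (fun ε hε _ => toReal_volume_cap_le hn hv0 hvG hε) hp
  · rintro ⟨s, rfl⟩ p hp
    obtain ⟨A, hA⟩ := exists_toReal_volume_polytope_cap_le
      (fun x hx => hvG x (subset_convexHull ℝ _ hx))
    exact not_rpow_le_quasiDist_of_cap hGconvex hGcompact hv hv0 hvG hw hwv
      (by exact_mod_cast hn) (fun ε hε _ => hA ε hε) hp
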